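/- **Setting.** Let $\mathcal X\subseteq\mathbb R^{d_x}$, $\mathcal Y\subseteq\mathbb R^{d_y}$, $\mathcal Z\subseteq\mathbb R^{d_z}$, $p\in[1,\infty)$, $\iota\ge 0$. Let $X,Y$ be random vectors with values in $\mathcal X,\mathcal Y$ on a probability space $(\Omega,\mathcal F,\mathbb P)$, with joint distribution $P$, marginal $P_X$ and (a version of) the conditional distribution $x\mapsto P_{Y|X=x}$, $x\in\mathcal X$. Let $\rho^{(2)}$ be a law-invariant convex risk measure on $L^p$ of a probability space carrying a uniform $[0,1]$ variable $U$, i.e. a real-valued functional that is monotone, cash-invariant ($\rho(\xi+a)=\rho(\xi)+a$), convex, and equal at variables with the same distribution. For a distribution $Q$ on $\mathbb R$ with finite $p$-th moment put $\varrho(Q)=\rho^{(2)}(F_Q^{-1}(U))$, and for a cost $c:\mathcal Z\times\mathcal Y\to\mathbb R$ let $$R_x(z)=\rho^{(2)}_{P_{Y|X=x}}(c(z,Y)):=\varrho\bigl(P_{Y|X=x}\circ c(z,\cdot)^{-1}\bigr).$$ A point $z\in\mathcal Z$ is *conditionally optimal* at $x$ if it minimizes $R_x$ over $\mathcal Z$.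 Policies are the continuous maps $g:\mathcal X\to\mathcal Z$. **Assumptions.** 1. $c$ is continuous on $\mathcal Z\times\mathcal Y$ and $|c(z,y)|\le\eta(z)(\|y\|^{\iota}+1)$ for some locally bounded $\eta:\mathcal Z\to[0,\infty)$. 2. Each $P_{Y|X=x}$ has finite $\iota p$-th moment, and $x\mapsto P_{Y|X=x}$ is continuous for the $\|\cdot\|^{\iota p}$-weak topology: $x\mapsto\int h\,dP_{Y|X=x}$ is continuous for every continuous $h$ on $\mathcal Y$ with $|h(y)|\le c_0(\|y\|^{\iota p}+1)$ for some $c_0$. 3. For $P_X$-almost every $x$, $\min_{z\in\mathcal Z}R_x(z)$ is finite and attained at exactly one point. 4. At least one of the following holds: - (A) the conditional problems are convex: $\mathcal Z$ is closed and convex, and $R_x$ is convex on $\mathcal Z$ for every $x\in\mathcal X$; - (B) $\mathcal Z$ is compact. **Definitions.** A functional $\rho^{(1)}:L^p(\Omega,\mathbb P)\to\mathbb R$ is *strictly monotone* if $\rho^{(1)}(\xi)>\rho^{(1)}(\zeta)$ whenever $\xi\ge\zeta$ a.s. and $\mathbb P(\xi>\zeta)>0$. An *ex ante risk mapping* $\rho^{\mathrm{EA}}$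 assigns to every joint distribution $P'$ on $\mathcal X\times\mathcal Y$ a functional $\rho^{\mathrm{EA}}_{P'}:L^p(P')\to\mathbb R$. It is *strictly contextually consistent* for $\rho^{(2)}$ if, for every joint distribution $P'$ of $(X',Y')$, every version of the conditional distribution of $Y'$ given $X'$, every continuous $c':\mathcal Z\times\mathcal Y\to\mathbb R$ and all policies $g_1,g_2$ with losses $c'(g_i(X'),Y')$ in $L^p$: if $$\rho^{(2)}_{P'_{Y'|X'=x}}(c'(g_1(x),Y'))\le\rho^{(2)}_{P'_{Y'|X'=x}}(c'(g_2(x),Y'))$$ for almost every $x$, with strict inequality with positive probability, then $\rho^{\mathrm{EA}}_{P'}(c'(g_1(X'),Y'))<\rho^{\mathrm{EA}}_{P'}(c'(g_2(X'),Y'))$. A policy $g$ is *admissible for the ex ante problem* if $c(g(X),Y)\in L^p(\Omega,\mathbb P)$, and *admissible for the ex post problem* if $R_X(g(X))\in L^p(\Omega,\mathbb P)$. **Theorem.** (i) Let $\mathcal X_0$ be the set of $x\in\mathcal X$ at which the conditionally optimal point is unique. The conditionally optimal policy $z^*(x)=\arg\min_{z\in\mathcal Z}R_x(z)$ is continuous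 on $\mathcal X_0$ (hence on all of $\mathcal X$ if the minimizer is unique for every $x\in\mathcal X$). (ii) Let $\rho^{\mathrm{EA}}$ be strictly contextually consistent for $\rho^{(2)}$. Assume that (A) holds, or that the minimizer is unique for every $x\in\mathcal X$ and all policies are admissible for the ex ante problem. If $g^*$ minimizes $\rho^{\mathrm{EA}}_P(c(g(X),Y))$ over the policies admissible for the ex ante problem, then $g^*(x)$ is conditionally optimal at $x$ for $P_X$-almost every $x$. (iii) Let $\rho^{(1)}$ be strictly monotone. Assume that (A) holds, or that the minimizer is unique for every $x\in\mathcal X$ and all policies are admissible for the ex post problem. If $g^*$ minimizes the nested risk $\rho^{(1)}\bigl(R_X(g(X))\bigr)$ over the policies admissible for the ex post problem, then $g^*(x)$ is conditionally optimal at $x$ for $P_X$-almost every $x$. -/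

import Mathlib

open MeasureTheory ProbabilityTheory Set Filter Topology

namespace ContextualRisk

noncomputable section

/-- Monotone, cash-invariant and convex functionals on `L^p(Ω, Pr)`. A functional on `L^p` is
represented by a function on random variables of which only the values at elements of `L^p`
matter. -/
structure IsConvexRiskMeasure {Ω : Type*} [MeasurableSpace Ω] (Pr : Measure Ω) (p : ℝ)
    (ρ : (Ω → ℝ) → ℝ) : Prop where
  monotone : ∀ ξ ζ : Ω → ℝ, MemLp ξ (ENNReal.ofReal p) Pr → MemLp ζ (ENNReal.ofReal p) Pr →
    (∀ᵐ ω ∂Pr, ζ ω ≤ ξ ω) → ρ ζ ≤ ρ ξ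
  cash_invariant : ∀ (ξ : Ω → ℝ) (a : ℝ), MemLp ξ (ENNReal.ofReal p) Pr →
    ρ (fun ω => ξ ω + a) = ρ ξ + a
  convex : ∀ (ξ ζ : Ω → ℝ) (t : ℝ), MemLp ξ (ENNReal.ofReal p) Pr →
    MemLp ζ (ENNReal.ofReal p) Pr → 0 ≤ t → t ≤ 1 →
    ρ (fun ω => t * ξ ω + (1 - t) * ζ ω) ≤ t * ρ ξ + (1 - t) * ρ ζ

/-- `ρ` takes the same value at any two elements of `L^p` with the same distribution. -/
def IsLawInvariant {Ω : Type*} [MeasurableSpace Ω] (Pr : Measure Ω) (p : ℝ)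
    (ρ : (Ω → ℝ) → ℝ) : Prop :=
  ∀ ξ ζ : Ω → ℝ, MemLp ξ (ENNReal.ofReal p) Pr → MemLp ζ (ENNReal.ofReal p) Pr →
    Pr.map ξ = Pr.map ζ → ρ ξ = ρ ζ

/-- `ρ ζ < ρ ξ` whenever `ζ ≤ ξ` almost surely and `ζ < ξ` with positive probability. -/
def IsStrictlyMonotone {Ω : Type*} [MeasurableSpace Ω] (Pr : Measure Ω) (p : ℝ)
    (ρ : (Ω → ℝ) → ℝ) : Prop :=
  ∀ ξ ζ : Ω → ℝ, MemLp ξ (ENNReal.ofReal p) Pr → MemLp ζ (ENNReal.ofReal p) Pr →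
    (∀ᵐ ω ∂Pr, ζ ω ≤ ξ ω) → 0 < Pr {ω | ζ ω < ξ ω} → ρ ζ < ρ ξ

/-- `U` is uniformly distributed on `[0, 1]`. -/
def IsUniform {S : Type*} [MeasurableSpace S] (Pr : Measure S) (U : S → ℝ) : Prop :=
  Measurable U ∧ Pr.map U = (volume : Measure ℝ).restrict (Icc 0 1)

/-- The quantile function `F_Q⁻¹(u) = inf {t | u ≤ F_Q(t)}`. -/
def quantile (Q : Measure ℝ) (u : ℝ) : ℝ := sInf {t : ℝ | u ≤ Q.real (Iic t)}

/-- The risk functional on distributions induced by a law-invariant `ρ`: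
`ϱ(Q) = ρ(F_Q⁻¹(U))`, for `U` uniformly distributed on `[0, 1]`. -/
def lawRisk {S : Type*} (ρ : (S → ℝ) → ℝ) (U : S → ℝ) (Q : Measure ℝ) : ℝ :=
  ρ (fun s => quantile Q (U s))

/-- The conditional risk `ρ_{P_{Y|X=x}}(c(z, Y)) = ϱ(P_{Y|X=x} ∘ c(z, ·)⁻¹)`. -/
def condRisk {S 𝒳 𝒴 𝒵 : Type*} [MeasurableSpace 𝒳] [MeasurableSpace 𝒴]
    (ρ : (S → ℝ) → ℝ) (U : S → ℝ) (κ : Kernel 𝒳 𝒴) (c : 𝒵 → 𝒴 → ℝ) (x : 𝒳) (z : 𝒵) : ℝ :=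
  lawRisk ρ U ((κ x).map (c z))

/-- `z` attains `min_z ρ_{P_{Y|X=x}}(c(z, Y))`. -/
def IsCondOptimal {S 𝒳 𝒴 𝒵 : Type*} [MeasurableSpace 𝒳] [MeasurableSpace 𝒴]
    (ρ : (S → ℝ) → ℝ) (U : S → ℝ) (κ : Kernel 𝒳 𝒴) (c : 𝒵 → 𝒴 → ℝ) (x : 𝒳) (z : 𝒵) : Prop :=
  ∀ z' : 𝒵, condRisk ρ U κ c x z ≤ condRisk ρ U κ c x z'

/-- The conditional problem at `x` has exactly one optimal solution (so its minimum is attained,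
and finite, since the risk is real-valued). -/
def HasUniqueCondOptimal {S 𝒳 𝒴 𝒵 : Type*} [MeasurableSpace 𝒳] [MeasurableSpace 𝒴]
    (ρ : (S → ℝ) → ℝ) (U : S → ℝ) (κ : Kernel 𝒳 𝒴) (c : 𝒵 → 𝒴 → ℝ) (x : 𝒳) : Prop :=
  ∃! z : 𝒵, IsCondOptimal ρ U κ c x z

/-- The growth condition `|c(z, y)| ≤ η(z) (‖y‖^ι + 1)` for some locally bounded `η ≥ 0`. -/
def HasGrowth {𝒴 𝒵 : Type*} [TopologicalSpace 𝒵] (nrm : 𝒴 → ℝ) (ι : ℝ)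
    (c : 𝒵 → 𝒴 → ℝ) : Prop :=
  ∃ η : 𝒵 → ℝ, (∀ z, 0 ≤ η z) ∧ (∀ z, ∃ M : ℝ, ∀ᶠ z' in 𝓝 z, η z' ≤ M) ∧
    ∀ z y, |c z y| ≤ η z * (nrm y ^ ι + 1)

/-- `x ↦ κ x` is continuous into the measures with finite `q`-th moment, with the
`‖·‖^q`-weak topology: the coarsest one for which `Q ↦ ∫ h dQ` is continuous for all continuous
`h` with `|h(y)| ≤ c₀ (‖y‖^q + 1)`. -/
def IsWeaklyContinuous {𝒳 𝒴 : Type*} [MeasurableSpace 𝒳] [MeasurableSpace 𝒴]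
    [TopologicalSpace 𝒳] [TopologicalSpace 𝒴] (nrm : 𝒴 → ℝ) (q : ℝ) (κ : Kernel 𝒳 𝒴) : Prop :=
  (∀ x, Integrable (fun y => nrm y ^ q) (κ x)) ∧
    ∀ h : 𝒴 → ℝ, Continuous h → (∃ c₀ : ℝ, ∀ y, |h y| ≤ c₀ * (nrm y ^ q + 1)) →
      Continuous (fun x => ∫ y, h y ∂(κ x))

/-- All conditional problems are convex: the decision set `Z` is closed and convex, and
`z ↦ ρ_{P_{Y|X=x}}(c(z, Y))` is convex on `Z` for every `x`. -/
def IsConvexProblem {S 𝒳 𝒴 E : Type*} [MeasurableSpace 𝒳] [MeasurableSpace 𝒴]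
    [NormedAddCommGroup E] [NormedSpace ℝ E] (Z : Set E)
    (ρ : (S → ℝ) → ℝ) (U : S → ℝ) (κ : Kernel 𝒳 𝒴) (c : Z → 𝒴 → ℝ) : Prop :=
  IsClosed Z ∧ Convex ℝ Z ∧
    ∀ (x : 𝒳) (z₁ z₂ z : Z) (t : ℝ), 0 ≤ t → t ≤ 1 →
      (z : E) = t • (z₁ : E) + (1 - t) • (z₂ : E) →
      condRisk ρ U κ c x z ≤ t * condRisk ρ U κ c x z₁ + (1 - t) * condRisk ρ U κ c x z₂

/-- The loss `c(g(X), Y)` of the policy `g`, as a function of `(x, y)`. -/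
def loss {𝒳 𝒴 𝒵 : Type*} (c : 𝒵 → 𝒴 → ℝ) (g : 𝒳 → 𝒵) : 𝒳 × 𝒴 → ℝ := fun w => c (g w.1) w.2

/-- An ex ante risk mapping `ρEA` assigns to a joint distribution `P` of `(X, Y)` and a loss in
`L^p(P)` a number. It is strictly contextually consistent for the conditional risk if, for all joint
distributions, continuous costs and continuous policies (with losses in `L^p`), a policy that has at
most the conditional risk of another one in almost every context, and strictly less with positive
probability, has strictly less ex ante risk. -/
def IsStrictlyContextuallyConsistent {S 𝒳 𝒴 : Type*} (𝒵 : Type*)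
    [MeasurableSpace 𝒳] [MeasurableSpace 𝒴]
    [TopologicalSpace 𝒳] [TopologicalSpace 𝒴] [TopologicalSpace 𝒵] (p : ℝ)
    (ρ : (S → ℝ) → ℝ) (U : S → ℝ) (ρEA : Measure (𝒳 × 𝒴) → (𝒳 × 𝒴 → ℝ) → ℝ) : Prop :=
  ∀ (P : Measure (𝒳 × 𝒴)) (κ : Kernel 𝒳 𝒴), IsProbabilityMeasure P → IsMarkovKernel κ →
    P = P.fst ⊗ₘ κ →
    ∀ (c : 𝒵 → 𝒴 → ℝ) (g₁ g₂ : 𝒳 → 𝒵), Continuous (Function.uncurry c) →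
      Continuous g₁ → Continuous g₂ →
      MemLp (loss c g₁) (ENNReal.ofReal p) P → MemLp (loss c g₂) (ENNReal.ofReal p) P →
      (∀ᵐ x ∂P.fst, condRisk ρ U κ c x (g₁ x) ≤ condRisk ρ U κ c x (g₂ x)) →
      0 < P.fst {x | condRisk ρ U κ c x (g₁ x) < condRisk ρ U κ c x (g₂ x)} →
      ρEA P (loss c g₁) < ρEA P (loss c g₂)

/-- `g` minimizes `obj` over the continuous policies at which `obj` is defined (`adm`). -/
def IsOptimalPolicy {𝒳 𝒵 : Type*} [TopologicalSpace 𝒳] [TopologicalSpace 𝒵]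
    (adm : (𝒳 → 𝒵) → Prop) (obj : (𝒳 → 𝒵) → ℝ) (g : 𝒳 → 𝒵) : Prop :=
  Continuous g ∧ adm g ∧ ∀ g' : 𝒳 → 𝒵, Continuous g' → adm g' → obj g ≤ obj g'

/-- The ex ante loss of the policy `g` lies in `L^p(P)`. -/
def ExAnteAdmissible {𝒳 𝒴 𝒵 : Type*} [MeasurableSpace 𝒳] [MeasurableSpace 𝒴]
    (p : ℝ) (P : Measure (𝒳 × 𝒴)) (c : 𝒵 → 𝒴 → ℝ) (g : 𝒳 → 𝒵) : Prop :=
  MemLp (loss c g) (ENNReal.ofReal p) P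

/-- The random variable `ρ_{P_{Y|X}}(c(g(X), Y))`. -/
def condRiskVar {Ω S 𝒳 𝒴 𝒵 : Type*} [MeasurableSpace 𝒳] [MeasurableSpace 𝒴]
    (ρ : (S → ℝ) → ℝ) (U : S → ℝ) (κ : Kernel 𝒳 𝒴) (c : 𝒵 → 𝒴 → ℝ) (X : Ω → 𝒳) (g : 𝒳 → 𝒵) :
    Ω → ℝ :=
  fun ω => condRisk ρ U κ c (X ω) (g (X ω))

/-- The conditional risk of the policy `g`, as a random variable, lies in `L^p(Pr)`. -/
def ExPostAdmissible {Ω S 𝒳 𝒴 𝒵 : Type*} [MeasurableSpace Ω] [MeasurableSpace 𝒳]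
    [MeasurableSpace 𝒴] (p : ℝ) (Pr : Measure Ω)
    (ρ : (S → ℝ) → ℝ) (U : S → ℝ) (κ : Kernel 𝒳 𝒴) (c : 𝒵 → 𝒴 → ℝ) (X : Ω → 𝒳) (g : 𝒳 → 𝒵) :
    Prop :=
  MemLp (condRiskVar ρ U κ c X g) (ENNReal.ofReal p) Pr

end

end ContextualRisk

open ContextualRisk

/-!
The heart of the matter is that the conditional risk `R x z = ρ(F⁻¹(U))`, with `F` the conditional
distribution function of the loss `c(z, Y)` given `X = x`, is jointly continuous in `(x, z)`
(`continuous_condRisk`). Three facts combine here.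

* Integrals of `f z` against `κ x` are jointly continuous in `(x, z)` for continuous `f` of the
  admitted growth (`IsWeaklyContinuous.continuous_integral`). Hence the conditional loss
  distributions are weakly continuous in `(x, z)`, and so are their `p`-th moments.
* Weak convergence together with convergence of `p`-th moments implies `L^p` convergence of the
  quantile functions (`tendsto_quantile_of_tendsto`, `tendsto_eLpNorm_sub_of_tendsto_integral`).
* A finite monotone convex functional on the Banach lattice `L^p` is continuous
  (`continuous_of_monotone_of_convexOn`).

Given joint continuity, a unique minimizer is stable under small changes of the context, since it is
strictly better than all decisions in a compact set that separates it from the far ones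
(`eventually_dist_minimizer_lt`); this is the continuity of the optimal policy.

For the optimality of a policy `gstar` that solves the ex ante or the ex post problem, suppose that
it is conditionally suboptimal with positive probability. Then there is an admissible continuous
policy whose conditional risk is nowhere larger and is smaller with positive probability
(`exists_improving_policy`). If the minimizer is unique everywhere, this is the optimal policy itself.
In the convex case the optimal policy may fail to extend continuously to all contexts, and it is
enough to modify `gstar` near one context in whose neighbourhood it can be improved by a fixed
decision. Strict contextual consistency, or strict monotonicity, contradicts the optimality of
`gstar`. Both kinds of admissibility say that a continuous nonnegative function of `(x, z)` is
integrable along the policy, so that one construction serves both problems.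
-/

namespace ContextualRisk

/-! ### Convex functionals on Banach lattices and convergence in `L^p` -/

/-- A finite monotone convex functional on a Banach lattice is continuous. If it were unbounded above
near `0`, there would be `ξ n` with `‖ξ n‖ ≤ 2⁻ⁿ` and `n < f (ξ n)`; but all `ξ n` lie below
`∑ |ξ n|`, where `f` is finite. -/
theorem continuous_of_monotone_of_convexOn {E : Type*} [NormedAddCommGroup E] [NormedSpace ℝ E]
    [CompleteSpace E] [Lattice E] [IsOrderedAddMonoid E] [HasSolidNorm E] {f : E → ℝ}
    (hm : Monotone f) (hc : ConvexOn ℝ univ f) : Continuous f := by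
  rw [← continuousOn_univ]
  refine ((hc.continuousOn_tfae isOpen_univ univ_nonempty).out 1 3).mpr ?_
  refine ⟨0, mem_univ _, ?_⟩
  by_contra hunb
  have hex : ∀ n : ℕ, ∃ ξ : E, ‖ξ‖ ≤ (1 / 2 : ℝ) ^ n ∧ (n : ℝ) < f ξ := by
    intro n
    by_contra! h
    refine hunb ⟨n, ?_⟩
    rw [eventually_map]
    filter_upwards [Metric.closedBall_mem_nhds (0 : E) (by positivity : (0 : ℝ) < (1 / 2) ^ n)]
      with ξ hξ
    exact h ξ (by simpa using hξ)
  choose ξ hξ hfξ using hex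
  have hsum : Summable fun n => |ξ n| :=
    Summable.of_norm_bounded summable_geometric_two
      (fun n => by simpa only [norm_abs_eq_norm] using hξ n)
  obtain ⟨n, hn⟩ := exists_nat_gt (f (∑' n, |ξ n|))
  have : ξ n ≤ ∑' n, |ξ n| :=
    (le_abs_self _).trans (hsum.le_tsum n fun _ _ => abs_nonneg _)
  linarith [hm this, hfξ n]

theorem rpow_add_le_mul_rpow_add_rpow {a b p : ℝ} (ha : 0 ≤ a) (hb : 0 ≤ b) (hp : 1 ≤ p) :
    (a + b) ^ p ≤ 2 ^ (p - 1) * (a ^ p + b ^ p) := by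
  lift a to NNReal using ha
  lift b to NNReal using hb
  exact_mod_cast NNReal.rpow_add_le_mul_rpow_add_rpow a b hp

/-- Almost everywhere convergence together with convergence of the `p`-th absolute moments implies
convergence in `L^p`. -/
theorem tendsto_eLpNorm_sub_of_tendsto_integral {α : Type*} [MeasurableSpace α] {μ : Measure α}
    {p : ℝ} (hp : 1 ≤ p) {g : ℕ → α → ℝ} {g₀ : α → ℝ}
    (hg : ∀ n, MemLp (g n) (ENNReal.ofReal p) μ) (hg₀ : MemLp g₀ (ENNReal.ofReal p) μ)
    (hae : ∀ᵐ a ∂μ, Tendsto (fun n => g n a) atTop (𝓝 (g₀ a)))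
    (hint : Tendsto (fun n => ∫ a, |g n a| ^ p ∂μ) atTop (𝓝 (∫ a, |g₀ a| ^ p ∂μ))) :
    Tendsto (fun n => eLpNorm (g n - g₀) (ENNReal.ofReal p) μ) atTop (𝓝 0) := by
  have hp0 : 0 < p := by linarith
  have hpr : (ENNReal.ofReal p).toReal = p := ENNReal.toReal_ofReal hp0.le
  have hI : ∀ {f : α → ℝ}, MemLp f (ENNReal.ofReal p) μ → Integrable (fun a => |f a| ^ p) μ := by
    intro f hf
    simpa [hpr] using hf.integrable_norm_rpow (by simpa using hp0) (by simp)
  have hd : ∀ n, Integrable (fun a => |g n a - g₀ a| ^ p) μ := fun n => hI ((hg n).sub hg₀)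
  set C : ℝ := 2 ^ (p - 1) with hC
  have hC0 : 0 ≤ C := by positivity
  have hpow : ∀ a b : ℝ, |a - b| ^ p ≤ C * (|a| ^ p + |b| ^ p) := by
    intro a b
    refine (Real.rpow_le_rpow (abs_nonneg _) (abs_sub a b) hp0.le).trans ?_
    exact rpow_add_le_mul_rpow_add_rpow (abs_nonneg _) (abs_nonneg _) hp
  -- The positive part of `w n` is dominated by `2 C |g₀| ^ p`, whereas `∫ w n` differs from
  -- `∫ |g n - g₀| ^ p` only by a multiple of the difference of the moments.
  set w : ℕ → α → ℝ := fun n a => |g n a - g₀ a| ^ p - C * (|g n a| ^ p - |g₀ a| ^ p) with hw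
  have hwi : ∀ n, Integrable (w n) μ := fun n =>
    (hd n).sub (((hI (hg n)).sub (hI hg₀)).const_mul C)
  have hlim : Tendsto (fun n => ∫ a, max (w n a) 0 ∂μ) atTop (𝓝 (∫ _, (0 : ℝ) ∂μ)) := by
    refine tendsto_integral_of_dominated_convergence (fun a => 2 * C * |g₀ a| ^ p)
      (fun n => (hwi n).pos_part.aestronglyMeasurable) ((hI hg₀).const_mul _) ?_ ?_
    · intro n
      refine Eventually.of_forall fun a => ?_
      rw [Real.norm_of_nonneg (le_max_right _ _)]
      refine max_le ?_ (by positivity)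
      have := hpow (g n a) (g₀ a)
      simp only [hw]; linarith
    · filter_upwards [hae] with a ha
      have h1 : Tendsto (fun n => |g n a - g₀ a| ^ p) atTop (𝓝 (|g₀ a - g₀ a| ^ p)) :=
        ((ha.sub_const _).abs).rpow_const (Or.inr hp0.le)
      have h2 : Tendsto (fun n => |g n a| ^ p) atTop (𝓝 (|g₀ a| ^ p)) :=
        ha.abs.rpow_const (Or.inr hp0.le)
      have h3 := (h1.sub ((h2.sub_const (|g₀ a| ^ p)).const_mul C)).max
        (tendsto_const_nhds (x := (0 : ℝ)))
      simpa [Real.zero_rpow hp0.ne'] using h3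
  have hD : Tendsto (fun n => ∫ a, |g n a - g₀ a| ^ p ∂μ) atTop (𝓝 0) := by
    have h4 := hlim.add ((hint.sub_const (∫ a, |g₀ a| ^ p ∂μ)).const_mul C)
    simp only [integral_zero, sub_self, mul_zero, add_zero] at h4
    refine squeeze_zero (fun n => integral_nonneg fun a => by positivity) (fun n => ?_) h4
    have h5 : ∫ a, w n a ∂μ ≤ ∫ a, max (w n a) 0 ∂μ :=
      integral_mono (hwi n) (hwi n).pos_part fun a => le_max_left _ _
    have h6 : ∫ a, w n a ∂μ = ∫ a, |g n a - g₀ a| ^ p ∂μ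
        - C * (∫ a, |g n a| ^ p ∂μ - ∫ a, |g₀ a| ^ p ∂μ) := by
      rw [← integral_sub (hI (hg n)) (hI hg₀), ← integral_const_mul]
      exact integral_sub (hd n) (((hI (hg n)).sub (hI hg₀)).const_mul C)
    linarith
  have heq : ∀ n, eLpNorm (g n - g₀) (ENNReal.ofReal p) μ
      = ENNReal.ofReal ((∫ a, |g n a - g₀ a| ^ p ∂μ) ^ p⁻¹) := by
    intro n
    rw [((hg n).sub hg₀).eLpNorm_eq_integral_rpow_norm (by simpa using hp0) (by simp), hpr]
    simp
  simp_rw [heq]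
  have := (ENNReal.continuous_ofReal.tendsto _).comp
    (hD.rpow_const (p := p⁻¹) (Or.inr (by positivity)))
  simpa [Function.comp_def, Real.zero_rpow (inv_ne_zero hp0.ne')] using this

/-! ### Quantile functions -/

/-- The Galois connection between quantile function and distribution function. It needs `u` in the
open interval: at `0` and `1` the infimum may be taken over an unbounded or empty set. -/
theorem quantile_le_iff (Q : Measure ℝ) [IsProbabilityMeasure Q] {u : ℝ} (hu : u ∈ Ioo (0 : ℝ) 1)
    (t : ℝ) : quantile Q u ≤ t ↔ u ≤ Q.real (Iic t) := by
  simp_rw [quantile, ← cdf_eq_real]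
  set A : Set ℝ := {t | u ≤ cdf Q t} with hA
  have hne : A.Nonempty :=
    ((tendsto_cdf_atTop Q).eventually (eventually_ge_nhds hu.2)).exists
  have hbdd : BddBelow A := by
    obtain ⟨b, hb⟩ := ((tendsto_cdf_atBot Q).eventually (eventually_lt_nhds hu.1)).exists
    refine ⟨b, fun t ht => ?_⟩
    by_contra! h
    exact absurd (ht.trans (monotone_cdf Q h.le)) (not_le.mpr hb)
  have hmem : sInf A ∈ A := by
    have hr : Tendsto (cdf Q) (𝓝[>] (sInf A)) (𝓝 (cdf Q (sInf A))) :=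
      ((cdf Q).right_continuous (sInf A)).mono_left (nhdsWithin_mono _ Ioi_subset_Ici_self)
    refine ge_of_tendsto hr ?_
    filter_upwards [self_mem_nhdsWithin] with t ht
    obtain ⟨s, hs, hst⟩ := exists_lt_of_csInf_lt hne ht
    exact le_trans hs (monotone_cdf Q hst.le)
  exact ⟨fun h => le_trans hmem (monotone_cdf Q h), fun h => csInf_le hbdd h⟩

theorem monotoneOn_quantile (Q : Measure ℝ) [IsProbabilityMeasure Q] :
    MonotoneOn (quantile Q) (Ioo 0 1) := fun _ hu _ hv huv =>
  (quantile_le_iff Q hu _).mpr (huv.trans ((quantile_le_iff Q hv _).mp le_rfl))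

theorem aemeasurable_quantile (Q : Measure ℝ) [IsProbabilityMeasure Q] :
    AEMeasurable (quantile Q) (volume.restrict (Icc 0 1)) := by
  rw [← Measure.restrict_congr_set (Ioo_ae_eq_Icc (μ := volume) (a := (0 : ℝ)) (b := 1))]
  exact aemeasurable_restrict_of_monotoneOn measurableSet_Ioo (monotoneOn_quantile Q)

instance isProbabilityMeasure_volume_restrict_Icc :
    IsProbabilityMeasure ((volume : Measure ℝ).restrict (Icc 0 1)) := ⟨by simp⟩

/-- The quantile function of `Q` carries the uniform distribution on `[0, 1]` to `Q`. -/
theorem map_quantile (Q : Measure ℝ) [IsProbabilityMeasure Q] :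
    (volume.restrict (Icc 0 1)).map (quantile Q) = Q := by
  have hm := aemeasurable_quantile Q
  have : IsProbabilityMeasure ((volume.restrict (Icc (0 : ℝ) 1)).map (quantile Q)) :=
    Measure.isProbabilityMeasure_map hm
  refine Measure.ext_of_Iic _ _ fun t => ?_
  rw [Measure.map_apply_of_aemeasurable hm measurableSet_Iic,
    ← Measure.restrict_congr_set (Ioo_ae_eq_Icc (μ := volume) (a := (0 : ℝ)) (b := 1)),
    Measure.restrict_apply₀' measurableSet_Ioo.nullMeasurableSet]
  have hset : quantile Q ⁻¹' Iic t ∩ Ioo 0 1 = Ioc 0 (Q.real (Iic t)) ∩ Iio 1 := by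
    ext u
    constructor
    · rintro ⟨h, hu⟩
      exact ⟨⟨hu.1, (quantile_le_iff Q hu t).mp h⟩, hu.2⟩
    · rintro ⟨h, hu⟩
      exact ⟨(quantile_le_iff Q ⟨h.1, hu⟩ t).mpr h.2, h.1, hu⟩
  have hIio : (Iio 1 : Set ℝ) =ᵐ[volume] Iic 1 := Iio_ae_eq_Iic
  have hae : (Ioc 0 (Q.real (Iic t)) ∩ Iio 1 : Set ℝ) =ᵐ[volume]
      (Ioc 0 (Q.real (Iic t)) ∩ Iic 1 : Set ℝ) := (ae_eq_refl _).inter hIio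
  have hsub : (Ioc 0 (Q.real (Iic t)) ∩ Iic 1 : Set ℝ) = Ioc 0 (Q.real (Iic t)) :=
    inter_eq_left.mpr fun u hu => hu.2.trans measureReal_le_one
  rw [hset, measure_congr hae, hsub, Real.volume_Ioc, sub_zero, ofReal_measureReal]

/-- Under weak convergence the quantile functions converge at each continuity point of the limiting
one, hence almost everywhere, since a monotone function has countably many discontinuities. -/
theorem tendsto_quantile_of_tendsto {Q : ℕ → ProbabilityMeasure ℝ} {Q₀ : ProbabilityMeasure ℝ}
    (h : Tendsto Q atTop (𝓝 Q₀)) :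
    ∀ᵐ u ∂volume.restrict (Icc (0 : ℝ) 1),
      Tendsto (fun n => quantile (Q n) u) atTop (𝓝 (quantile Q₀ u)) := by
  rw [← Measure.restrict_congr_set (Ioo_ae_eq_Icc (μ := volume) (a := (0 : ℝ)) (b := 1)),
    ae_restrict_iff' measurableSet_Ioo]
  have hcount := (monotoneOn_quantile (Q₀ : Measure ℝ)).countable_not_continuousWithinAt
  filter_upwards [hcount.ae_notMem volume] with u hu hu01
  have hcont : ContinuousWithinAt (quantile Q₀) (Ioo 0 1) u := by
    by_contra hc; exact hu ⟨hu01, hc⟩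
  rw [tendsto_order]
  constructor
  · intro a ha
    have hlt : (Q₀ : Measure ℝ) (Iic a) < ENNReal.ofReal u := by
      rw [← ofReal_measureReal]
      refine (ENNReal.ofReal_lt_ofReal_iff hu01.1).mpr ?_
      by_contra! hle
      exact absurd ((quantile_le_iff _ hu01 a).mpr hle) (not_le.mpr ha)
    have := eventually_lt_of_limsup_lt
      ((ProbabilityMeasure.limsup_measure_closed_le_of_tendsto h isClosed_Iic).trans_lt hlt)
    filter_upwards [this] with n hn
    by_contra! hle
    rw [quantile_le_iff _ hu01] at hle
    exact absurd ((ENNReal.ofReal_le_ofReal hle).trans_eq (ofReal_measureReal)) (not_le.mpr hn)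
  · intro b hb
    obtain ⟨b'', hb''1, hb''2⟩ := exists_between hb
    obtain ⟨b', hb'1, hb'2⟩ := exists_between hb''1
    -- by continuity at `u`, some larger level still has its quantile below `b'`
    obtain ⟨v, hv01, huv, hvb⟩ : ∃ v ∈ Ioo (0 : ℝ) 1, u < v ∧ quantile Q₀ v < b' := by
      have h1 : ∀ᶠ v in 𝓝 u, v ∈ Ioo (0 : ℝ) 1 → quantile Q₀ v < b' :=
        eventually_nhdsWithin_iff.mp (hcont.eventually (eventually_lt_nhds hb'1))
      have h2 := (h1.and (Ioo_mem_nhds hu01.1 hu01.2)).filter_mono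
        (nhdsWithin_le_nhds (s := Ioi u))
      obtain ⟨v, ⟨hv, hv'⟩, hv''⟩ := (h2.and self_mem_nhdsWithin).exists
      exact ⟨v, hv', hv'', hv hv'⟩
    have hlt : ENNReal.ofReal u < (Q₀ : Measure ℝ) (Iio b'') := by
      have h3 := ENNReal.ofReal_le_ofReal ((quantile_le_iff _ hv01 b').mp hvb.le)
      rw [ofReal_measureReal] at h3
      exact ((ENNReal.ofReal_lt_ofReal_iff hv01.1).mpr huv).trans_le
        (h3.trans (measure_mono (Iic_subset_Iio.mpr hb'2)))
    have := eventually_lt_of_lt_liminf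
      (hlt.trans_le (ProbabilityMeasure.le_liminf_measure_open_of_tendsto h isOpen_Iio))
    filter_upwards [this] with n hn
    by_contra! hle
    have h4 : ¬ u ≤ (Q n : Measure ℝ).real (Iic b'') := fun h5 =>
      absurd (hle.trans ((quantile_le_iff _ hu01 b'').mpr h5)) (not_le.mpr hb''2)
    have h6 := ENNReal.ofReal_le_ofReal (not_le.mp h4).le
    rw [ofReal_measureReal] at h6
    exact absurd (hn.trans_le ((measure_mono Iio_subset_Iic_self).trans h6)) (lt_irrefl _)

/-! ### Joint continuity of integrals against a weakly continuous kernel -/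

section LipschitzEnvelope

variable {𝒴 𝒵 : Type*} [PseudoMetricSpace 𝒴] [PseudoMetricSpace 𝒵]

/-- The `k`-Lipschitz function `y ↦ inf {F z y' + k d(y, y')}`, the infimum being over all `y'` and
over all `z` at distance less than `1 / (k + 1)` from `z₀`. For `F ≥ 0` it lies below `F z` for every
such `z`, and it tends to `F z₀` as `k → ∞`. -/
noncomputable def lipEnvelope (F : 𝒵 → 𝒴 → ℝ) (z₀ : 𝒵) (k : ℕ) (y : 𝒴) : ℝ :=
  ⨅ v : Metric.ball z₀ (1 / ((k : ℝ) + 1)) × 𝒴, F v.1 v.2 + k * dist y v.2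

theorem nonempty_ball_prod {𝒴 : Type*} (z₀ : 𝒵) (k : ℕ) (y : 𝒴) :
    Nonempty (Metric.ball z₀ (1 / ((k : ℝ) + 1)) × 𝒴) :=
  ⟨⟨z₀, Metric.mem_ball_self (by positivity)⟩, y⟩

theorem lipEnvelope_nonneg {F : 𝒵 → 𝒴 → ℝ} (hF0 : ∀ z y, 0 ≤ F z y) (z₀ : 𝒵) (k : ℕ) (y : 𝒴) :
    0 ≤ lipEnvelope F z₀ k y :=
  Real.iInf_nonneg fun v => add_nonneg (hF0 _ _) (by positivity)

theorem lipEnvelope_le {F : 𝒵 → 𝒴 → ℝ} (hF0 : ∀ z y, 0 ≤ F z y) {z₀ z : 𝒵} {k : ℕ}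
    (hz : z ∈ Metric.ball z₀ (1 / ((k : ℝ) + 1))) (y y' : 𝒴) :
    lipEnvelope F z₀ k y ≤ F z y' + k * dist y y' :=
  ciInf_le (f := fun v : Metric.ball z₀ (1 / ((k : ℝ) + 1)) × 𝒴 => F v.1 v.2 + k * dist y v.2)
    ⟨0, by rintro _ ⟨v, rfl⟩; exact add_nonneg (hF0 _ _) (by positivity)⟩ (⟨z, hz⟩, y')

theorem continuous_lipEnvelope {F : 𝒵 → 𝒴 → ℝ} (hF0 : ∀ z y, 0 ≤ F z y) (z₀ : 𝒵) (k : ℕ) :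
    Continuous (lipEnvelope F z₀ k) := by
  refine (LipschitzWith.of_le_add_mul k fun y y' => ?_).continuous
  have := nonempty_ball_prod z₀ k y
  rw [← sub_le_iff_le_add]
  refine le_ciInf fun v => ?_
  have h1 := lipEnvelope_le hF0 v.1.2 y v.2
  have h2 : (k : ℝ) * dist y v.2 ≤ k * (dist y y' + dist y' v.2) := by
    gcongr; exact dist_triangle _ _ _
  simp only [NNReal.coe_natCast]
  linarith

theorem tendsto_lipEnvelope {F : 𝒵 → 𝒴 → ℝ} (hF : Continuous (Function.uncurry F))
    (hF0 : ∀ z y, 0 ≤ F z y) (z₀ : 𝒵) (y : 𝒴) :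
    Tendsto (fun k => lipEnvelope F z₀ k y) atTop (𝓝 (F z₀ y)) := by
  rw [tendsto_order]
  constructor
  · intro a ha
    obtain ⟨a', haa', ha'⟩ := exists_between ha
    have hnear := Metric.eventually_nhds_iff.mp
      ((hF.tendsto (z₀, y)).eventually (eventually_gt_nhds ha'))
    obtain ⟨δ, hδ, hnear⟩ := hnear
    have h1 : ∀ᶠ k : ℕ in atTop, 1 / ((k : ℝ) + 1) < δ :=
      tendsto_one_div_add_atTop_nhds_zero_nat.eventually (eventually_lt_nhds hδ)
    have h2 : ∀ᶠ k : ℕ in atTop, a' ≤ k * δ :=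
      (tendsto_natCast_atTop_atTop.atTop_mul_const hδ).eventually_ge_atTop _
    filter_upwards [h1, h2] with k hk1 hk2
    have := nonempty_ball_prod z₀ k y
    refine haa'.trans_le (le_ciInf fun v => ?_)
    rcases lt_or_ge (dist y v.2) δ with hd | hd
    · have h3 : a' < F v.1 v.2 := by
        refine hnear (y := (v.1.1, v.2)) ?_
        rw [Prod.dist_eq]
        exact max_lt ((Metric.mem_ball.mp v.1.2).trans hk1) (by rwa [dist_comm])
      have : 0 ≤ (k : ℝ) * dist y v.2 := by positivity
      linarith
    · have h3 : (k : ℝ) * δ ≤ k * dist y v.2 := by gcongr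
      linarith [hF0 v.1 v.2]
  · intro a ha
    refine Eventually.of_forall fun k => lt_of_le_of_lt ?_ ha
    simpa using lipEnvelope_le hF0 (Metric.mem_ball_self (x := z₀) (by positivity)) y y

end LipschitzEnvelope

section ParametricIntegral

variable {𝒳 𝒴 𝒵 : Type*} [MeasurableSpace 𝒳] [MeasurableSpace 𝒴] [TopologicalSpace 𝒳]
  [PseudoMetricSpace 𝒴] [BorelSpace 𝒴] [PseudoMetricSpace 𝒵]
  {nrm : 𝒴 → ℝ} {q : ℝ} {κ : Kernel 𝒳 𝒴} [IsMarkovKernel κ]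

theorem IsWeaklyContinuous.integrable_of_le (hweak : IsWeaklyContinuous nrm q κ) {h : 𝒴 → ℝ}
    (hh : Continuous h) {M : ℝ} (hM : ∀ y, |h y| ≤ M * (nrm y ^ q + 1)) (x : 𝒳) :
    Integrable h (κ x) :=
  (((hweak.1 x).add (integrable_const 1)).const_mul M).mono' hh.aestronglyMeasurable
    (Eventually.of_forall hM)

/-- Lower semicontinuity of `(x, z) ↦ ∫ F z dκ x` for `F ≥ 0`. The Lipschitz envelopes replace the
moving integrand `F z` by a fixed continuous one, to which weak continuity of `κ` applies; no
tightness is needed, so `𝒴` need not be complete. -/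
theorem IsWeaklyContinuous.eventually_lt_integral (hweak : IsWeaklyContinuous nrm q κ)
    {F : 𝒵 → 𝒴 → ℝ} (hF : Continuous (Function.uncurry F)) (hF0 : ∀ z y, 0 ≤ F z y)
    (hgr : HasGrowth nrm q F) {x₀ : 𝒳} {z₀ : 𝒵} {a : ℝ} (ha : a < ∫ y, F z₀ y ∂(κ x₀)) :
    ∀ᶠ v : 𝒳 × 𝒵 in 𝓝 (x₀, z₀), a < ∫ y, F v.2 y ∂(κ v.1) := by
  obtain ⟨η, -, -, hη⟩ := hgr
  have hFz : ∀ z, Continuous (F z) := fun z => hF.comp (Continuous.prodMk_right z)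
  have hFi : ∀ x z, Integrable (F z) (κ x) := fun x z =>
    hweak.integrable_of_le (hFz z) (hη z) x
  have hself : ∀ k : ℕ, z₀ ∈ Metric.ball z₀ (1 / ((k : ℝ) + 1)) := fun k =>
    Metric.mem_ball_self (by positivity)
  have hle : ∀ (k : ℕ) (z : 𝒵), z ∈ Metric.ball z₀ (1 / ((k : ℝ) + 1)) → ∀ y,
      lipEnvelope F z₀ k y ≤ F z y := fun k z hz y => by
    simpa using lipEnvelope_le hF0 hz y y
  have hbound : ∀ k y, |lipEnvelope F z₀ k y| ≤ η z₀ * (nrm y ^ q + 1) := fun k y => by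
    rw [abs_of_nonneg (lipEnvelope_nonneg hF0 z₀ k y)]
    exact (hle k z₀ (hself k) y).trans ((le_abs_self _).trans (hη z₀ y))
  have hlim : Tendsto (fun k => ∫ y, lipEnvelope F z₀ k y ∂(κ x₀)) atTop
      (𝓝 (∫ y, F z₀ y ∂(κ x₀))) := by
    refine tendsto_integral_of_dominated_convergence (F z₀)
      (fun k => (continuous_lipEnvelope hF0 z₀ k).aestronglyMeasurable) (hFi x₀ z₀) ?_ ?_
    · refine fun k => Eventually.of_forall fun y => ?_
      rw [Real.norm_of_nonneg (lipEnvelope_nonneg hF0 z₀ k y)]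
      exact hle k z₀ (hself k) y
    · exact Eventually.of_forall fun y => tendsto_lipEnvelope hF hF0 z₀ y
  obtain ⟨k, hk⟩ := (hlim.eventually (eventually_gt_nhds ha)).exists
  have hcont := hweak.2 _ (continuous_lipEnvelope hF0 z₀ k) ⟨_, hbound k⟩
  have h1 : ∀ᶠ x in 𝓝 x₀, a < ∫ y, lipEnvelope F z₀ k y ∂(κ x) :=
    (hcont.tendsto x₀).eventually (eventually_gt_nhds hk)
  have h2 : ∀ᶠ z in 𝓝 z₀, z ∈ Metric.ball z₀ (1 / ((k : ℝ) + 1)) :=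
    Metric.ball_mem_nhds _ (by positivity)
  rw [nhds_prod_eq]
  filter_upwards [h1.prod_mk h2] with v hv
  exact hv.1.trans_le (integral_mono
    (hweak.integrable_of_le (continuous_lipEnvelope hF0 z₀ k) (hbound k) _) (hFi _ _)
    (hle k v.2 hv.2))

/-- Weak continuity of `κ` extends to integrands that depend continuously on a parameter. Near `z₀` both
`M (nrm ^ q + 1) + f` and `M (nrm ^ q + 1) - f` are nonnegative, and lower semicontinuity of their
integrals gives continuity. -/
theorem IsWeaklyContinuous.continuous_integral (hweak : IsWeaklyContinuous nrm q κ)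
    (hnrm : Continuous nrm) (hnrm0 : ∀ y, 0 ≤ nrm y) (hq : 0 ≤ q)
    {f : 𝒵 → 𝒴 → ℝ} (hf : Continuous (Function.uncurry f)) (hgr : HasGrowth nrm q f) :
    Continuous fun v : 𝒳 × 𝒵 => ∫ y, f v.2 y ∂(κ v.1) := by
  have hwt : Continuous fun y => nrm y ^ q + 1 :=
    (hnrm.rpow_const fun _ => Or.inr hq).add continuous_const
  have hwt0 : ∀ y, 0 ≤ nrm y ^ q + 1 := fun y => by have := hnrm0 y; positivity
  have hwti : ∀ x, Integrable (fun y => nrm y ^ q + 1) (κ x) := fun x =>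
    (hweak.1 x).add (integrable_const 1)
  have hwtc : Continuous fun x => ∫ y, (nrm y ^ q + 1) ∂(κ x) :=
    hweak.2 _ hwt ⟨1, fun y => by rw [abs_of_nonneg (hwt0 y), one_mul]⟩
  have lower : ∀ {f : 𝒵 → 𝒴 → ℝ}, Continuous (Function.uncurry f) → HasGrowth nrm q f →
      ∀ (x₀ : 𝒳) (z₀ : 𝒵) (a : ℝ), a < ∫ y, f z₀ y ∂(κ x₀) →
      ∀ᶠ v : 𝒳 × 𝒵 in 𝓝 (x₀, z₀), a < ∫ y, f v.2 y ∂(κ v.1) := by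
    intro f hf ⟨η, hη0, hηb, hη⟩ x₀ z₀ a ha
    obtain ⟨M, hM⟩ := hηb z₀
    have hM0 : 0 ≤ M := (hη0 z₀).trans hM.self_of_nhds
    have hfi : ∀ x z, Integrable (f z) (κ x) := fun x z =>
      hweak.integrable_of_le (hf.comp (Continuous.prodMk_right z)) (hη z) x
    -- The truncation at `0` is inactive for `z` near `z₀`.
    set F : 𝒵 → 𝒴 → ℝ := fun z y => max (M * (nrm y ^ q + 1) + f z y) 0 with hFdef
    have hF : Continuous (Function.uncurry F) :=
      (((hwt.comp continuous_snd).const_mul M).add hf).max continuous_const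
    have hFgr : HasGrowth nrm q F := by
      refine ⟨fun z => M + η z, fun z => add_nonneg hM0 (hη0 z), fun z => ?_, fun z y => ?_⟩
      · obtain ⟨N, hN⟩ := hηb z
        exact ⟨M + N, hN.mono fun z' hz' => by linarith⟩
      · rw [abs_of_nonneg (le_max_right _ _), add_mul]
        have h1 := mul_nonneg hM0 (hwt0 y)
        refine max_le ?_ ?_
        · linarith [(le_abs_self _).trans (hη z y)]
        · linarith [(abs_nonneg _).trans (hη z y)]
    have hFint : ∀ x z, η z ≤ M →
        ∫ y, F z y ∂(κ x) = M * ∫ y, (nrm y ^ q + 1) ∂(κ x) + ∫ y, f z y ∂(κ x) := by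
      intro x z hz
      rw [← integral_const_mul, ← integral_add ((hwti x).const_mul M) (hfi x z)]
      refine integral_congr_ae (Eventually.of_forall fun y => max_eq_left ?_)
      have h1 := (neg_le_abs _).trans (hη z y)
      have h2 := mul_le_mul_of_nonneg_right hz (hwt0 y)
      linarith
    set I : 𝒳 → ℝ := fun x => M * ∫ y, (nrm y ^ q + 1) ∂(κ x)
    have hI : Continuous I := hwtc.const_mul M
    obtain ⟨b, hab, hb⟩ := exists_between ha
    have h1 := hweak.eventually_lt_integral hF (fun _ _ => le_max_right _ _) hFgr
      (x₀ := x₀) (z₀ := z₀) (a := I x₀ + b)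
      (by rw [hFint x₀ z₀ hM.self_of_nhds]; exact add_lt_add_right hb _)
    have h2 : ∀ᶠ v : 𝒳 × 𝒵 in 𝓝 (x₀, z₀), I v.1 < I x₀ + (b - a) :=
      ((hI.comp continuous_fst).tendsto (x₀, z₀)).eventually
        (eventually_lt_nhds (by simp; linarith))
    have h3 : ∀ᶠ v : 𝒳 × 𝒵 in 𝓝 (x₀, z₀), η v.2 ≤ M :=
      (continuous_snd.tendsto (x₀, z₀)).eventually hM
    filter_upwards [h1, h2, h3] with v h1 h2 h3
    rw [hFint _ _ h3] at h1
    change I x₀ + b < I v.1 + _ at h1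
    linarith
  rw [continuous_iff_continuousAt]
  rintro ⟨x₀, z₀⟩
  refine tendsto_order.mpr ⟨lower hf hgr x₀ z₀, fun a ha => ?_⟩
  have hneg : HasGrowth nrm q fun z y => - f z y := by
    obtain ⟨η, h1, h2, h3⟩ := hgr
    exact ⟨η, h1, h2, fun z y => by simpa using h3 z y⟩
  have := lower (f := fun z y => - f z y) hf.neg hneg x₀ z₀ (-a)
    (by rw [integral_neg]; exact neg_lt_neg ha)
  filter_upwards [this] with v hv
  rw [integral_neg] at hv
  exact neg_lt_neg_iff.mp hv

end ParametricIntegral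

/-! ### Joint continuity of the conditional risk -/

theorem memLp_quantile {Q : Measure ℝ} [IsProbabilityMeasure Q] {r : ENNReal}
    (hQ : MemLp id r Q) : MemLp (quantile Q) r (volume.restrict (Icc 0 1)) := by
  rw [← map_quantile Q,
    memLp_map_measure_iff aestronglyMeasurable_id (aemeasurable_quantile Q)] at hQ
  exact hQ

section RiskMeasure

variable {S : Type*} [MeasurableSpace S] {PrS : Measure S} {p : ℝ} {ρ : (S → ℝ) → ℝ}

/-- Monotonicity makes a functional on random variables well defined on almost everywhere classes. -/
theorem IsConvexRiskMeasure.congr_ae (hρ : IsConvexRiskMeasure PrS p ρ) {ξ ζ : S → ℝ}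
    (hξ : MemLp ξ (ENNReal.ofReal p) PrS) (h : ξ =ᵐ[PrS] ζ) : ρ ξ = ρ ζ :=
  have hζ := (memLp_congr_ae h).mp hξ
  le_antisymm (hρ.monotone ζ ξ hζ hξ h.le) (hρ.monotone ξ ζ hξ hζ h.symm.le)

theorem IsConvexRiskMeasure.continuous_Lp (hρ : IsConvexRiskMeasure PrS p ρ)
    [Fact (1 ≤ ENNReal.ofReal p)] :
    Continuous fun f : Lp ℝ (ENNReal.ofReal p) PrS => ρ f := by
  refine continuous_of_monotone_of_convexOn (fun f g hfg => ?_) ⟨convex_univ, ?_⟩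
  · exact hρ.monotone g f (Lp.memLp g) (Lp.memLp f) ((Lp.coeFn_le f g).mpr hfg)
  · intro f _ g _ a b ha hb hab
    obtain rfl : b = 1 - a := by linarith
    refine le_of_eq_of_le (hρ.congr_ae (Lp.memLp _) ?_)
      (hρ.convex f g a (Lp.memLp f) (Lp.memLp g) ha (by linarith))
    filter_upwards [Lp.coeFn_add (a • f) ((1 - a) • g), Lp.coeFn_smul a f,
      Lp.coeFn_smul (1 - a) g] with s h1 h2 h3
    rw [h1, Pi.add_apply, h2, h3]
    rfl

end RiskMeasure

section CondRisk

variable {𝒳 𝒴 𝒵 : Type*} [MeasurableSpace 𝒳] [MeasurableSpace 𝒴] [TopologicalSpace 𝒳]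
  [PseudoMetricSpace 𝒴] [BorelSpace 𝒴] [PseudoMetricSpace 𝒵]
  {nrm : 𝒴 → ℝ} {p ι : ℝ} {κ : Kernel 𝒳 𝒴} [IsMarkovKernel κ] {c : 𝒵 → 𝒴 → ℝ}

theorem HasGrowth.abs_rpow {𝒴 : Type*} {nrm : 𝒴 → ℝ} {c : 𝒵 → 𝒴 → ℝ}
    (hgr : HasGrowth nrm ι c) (hnrm0 : ∀ y, 0 ≤ nrm y) (hp : 1 ≤ p) :
    HasGrowth nrm (ι * p) fun z y => |c z y| ^ p := by
  obtain ⟨η, hη0, hηb, hη⟩ := hgr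
  have hp0 : 0 ≤ p := by linarith
  refine ⟨fun z => η z ^ p * 2 ^ (p - 1), fun z => by have := hη0 z; positivity, fun z => ?_,
    fun z y => ?_⟩
  · obtain ⟨M, hM⟩ := hηb z
    refine ⟨M ^ p * 2 ^ (p - 1), hM.mono fun z' hz' => ?_⟩
    exact mul_le_mul_of_nonneg_right (Real.rpow_le_rpow (hη0 z') hz' hp0) (by positivity)
  · have hy := Real.rpow_nonneg (hnrm0 y) ι
    rw [abs_of_nonneg (by positivity), Real.rpow_mul (hnrm0 y), mul_assoc]
    calc |c z y| ^ p ≤ (η z * (nrm y ^ ι + 1)) ^ p :=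
          Real.rpow_le_rpow (abs_nonneg _) (hη z y) hp0
      _ = η z ^ p * (nrm y ^ ι + 1) ^ p := Real.mul_rpow (hη0 z) (by positivity)
      _ ≤ η z ^ p * (2 ^ (p - 1) * ((nrm y ^ ι) ^ p + 1)) := by
          have := rpow_add_le_mul_rpow_add_rpow hy zero_le_one hp
          rw [Real.one_rpow] at this
          exact mul_le_mul_of_nonneg_left this (Real.rpow_nonneg (hη0 z) _)

theorem continuous_integral_abs_rpow (hweak : IsWeaklyContinuous nrm (ι * p) κ)
    (hnrm : Continuous nrm) (hnrm0 : ∀ y, 0 ≤ nrm y) (hp : 1 ≤ p) (hι : 0 ≤ ι)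
    (hc : Continuous (Function.uncurry c)) (hgr : HasGrowth nrm ι c) :
    Continuous fun v : 𝒳 × 𝒵 => ∫ y, |c v.2 y| ^ p ∂(κ v.1) :=
  hweak.continuous_integral hnrm hnrm0 (by positivity)
    (f := fun z y => |c z y| ^ p) (hc.abs.rpow_const fun _ => Or.inr (by positivity))
    (hgr.abs_rpow hnrm0 hp)

theorem integrable_abs_rpow (hweak : IsWeaklyContinuous nrm (ι * p) κ)
    (hnrm0 : ∀ y, 0 ≤ nrm y) (hp : 1 ≤ p)
    (hc : Continuous (Function.uncurry c)) (hgr : HasGrowth nrm ι c) (x : 𝒳) (z : 𝒵) :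
    Integrable (fun y => |c z y| ^ p) (κ x) := by
  obtain ⟨η, -, -, hη⟩ := hgr.abs_rpow hnrm0 hp
  exact hweak.integrable_of_le
    ((hc.comp (Continuous.prodMk_right z)).abs.rpow_const fun _ => Or.inr (by positivity)) (hη z) x

/-- A weakly continuous kernel pushed forward by a continuous cost depends continuously on context
and decision jointly. -/
theorem continuous_map_cost (hweak : IsWeaklyContinuous nrm (ι * p) κ)
    (hnrm : Continuous nrm) (hnrm0 : ∀ y, 0 ≤ nrm y) (hp : 1 ≤ p) (hι : 0 ≤ ι)
    (hc : Continuous (Function.uncurry c)) {Q : 𝒳 × 𝒵 → ProbabilityMeasure ℝ}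
    (hQ : ∀ v, (Q v : Measure ℝ) = (κ v.1).map (c v.2)) : Continuous Q := by
  rw [continuous_iff_continuousAt]
  intro v
  refine ProbabilityMeasure.tendsto_iff_forall_integral_tendsto.mpr fun φ => ?_
  have h1 : ∀ v, ∫ t, φ t ∂(Q v : Measure ℝ) = ∫ y, φ (c v.2 y) ∂(κ v.1) := fun v => by
    have h2 : Measurable (c v.2) := (hc.comp (Continuous.prodMk_right v.2)).measurable
    rw [hQ, integral_map h2.aemeasurable φ.continuous.aestronglyMeasurable]
  simp_rw [h1]
  refine (hweak.continuous_integral hnrm hnrm0 (by positivity) (f := fun z y => φ (c z y))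
    (φ.continuous.comp hc) ⟨fun _ => ‖φ‖, fun _ => norm_nonneg _,
      fun _ => ⟨‖φ‖, Eventually.of_forall fun _ => le_rfl⟩, fun z y => ?_⟩).tendsto v
  have h2 := Real.rpow_nonneg (hnrm0 y) (ι * p)
  exact (φ.norm_coe_le_norm _).trans (le_mul_of_one_le_right (norm_nonneg _) (by linarith))

/-- The conditional risk is jointly continuous in context and decision: the quantile functions of the
conditional loss distributions depend continuously on `(x, z)` in `L^p([0, 1])`, and a convex risk
measure is continuous on `L^p`. -/
theorem continuous_condRisk [FirstCountableTopology 𝒳]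
    {S : Type*} [MeasurableSpace S] {PrS : Measure S} {U : S → ℝ} (hU : IsUniform PrS U)
    {ρ : (S → ℝ) → ℝ} (hρ : IsConvexRiskMeasure PrS p ρ)
    (hweak : IsWeaklyContinuous nrm (ι * p) κ)
    (hnrm : Continuous nrm) (hnrm0 : ∀ y, 0 ≤ nrm y) (hp : 1 ≤ p) (hι : 0 ≤ ι)
    (hc : Continuous (Function.uncurry c)) (hgr : HasGrowth nrm ι c) :
    Continuous (Function.uncurry (condRisk ρ U κ c)) := by
  have hp0 : 0 < p := by linarith
  have hpr : (ENNReal.ofReal p).toReal = p := ENNReal.toReal_ofReal hp0.le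
  have hcm : ∀ z, Measurable (c z) := fun z => (hc.comp (Continuous.prodMk_right z)).measurable
  have : Fact (1 ≤ ENNReal.ofReal p) := ⟨by simpa using hp⟩
  let Q : 𝒳 × 𝒵 → ProbabilityMeasure ℝ := fun v =>
    ⟨(κ v.1).map (c v.2), Measure.isProbabilityMeasure_map (hcm v.2).aemeasurable⟩
  have hQcont : Continuous Q := continuous_map_cost hweak hnrm hnrm0 hp hι hc fun _ => rfl
  have hQp : ∀ v, MemLp id (ENNReal.ofReal p) (Q v : Measure ℝ) := fun v => by
    refine (memLp_map_measure_iff aestronglyMeasurable_id (hcm v.2).aemeasurable).mpr ?_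
    refine (integrable_norm_rpow_iff (hcm v.2).aestronglyMeasurable (by simpa using hp0)
      (by simp)).mp ?_
    simpa [hpr] using integrable_abs_rpow hweak hnrm0 hp hc hgr v.1 v.2
  have hqp : ∀ v, MemLp (quantile (Q v)) (ENNReal.ofReal p) (volume.restrict (Icc 0 1)) :=
    fun v => memLp_quantile (hQp v)
  have hmom : ∀ v, ∫ u in Icc (0 : ℝ) 1, |quantile (Q v) u| ^ p = ∫ y, |c v.2 y| ^ p ∂(κ v.1) := by
    intro v
    have habs : AEStronglyMeasurable (fun t : ℝ => |t| ^ p) (Q v : Measure ℝ) :=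
      (continuous_abs.rpow_const fun _ => Or.inr hp0.le).aestronglyMeasurable
    rw [← integral_map (φ := quantile (Q v)) (f := fun t => |t| ^ p) (aemeasurable_quantile _)
      (by rwa [map_quantile]), map_quantile]
    exact integral_map (hcm v.2).aemeasurable habs
  have hMem : ∀ v, MemLp (fun s => quantile (Q v) (U s)) (ENNReal.ofReal p) PrS := fun v =>
    (hU.2 ▸ hqp v).comp_of_map hU.1.aemeasurable
  have hcond : Function.uncurry (condRisk ρ U κ c) = fun v => ρ ((hMem v).toLp _) := by
    funext v
    exact hρ.congr_ae (hMem v) (hMem v).coeFn_toLp.symm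
  rw [hcond]
  refine hρ.continuous_Lp.comp (continuous_iff_seqContinuous.mpr fun v v₀ hv => ?_)
  refine (Lp.tendsto_Lp_iff_tendsto_eLpNorm'' _ (fun n => hMem (v n)) _ (hMem v₀)).mpr ?_
  have h1 := tendsto_eLpNorm_sub_of_tendsto_integral hp (fun n => hqp (v n)) (hqp v₀)
    (tendsto_quantile_of_tendsto ((hQcont.tendsto v₀).comp hv)) (by
      simp_rw [hmom]
      exact ((continuous_integral_abs_rpow hweak hnrm hnrm0 hp hι hc hgr).tendsto v₀).comp hv)
  refine h1.congr fun n => ?_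
  rw [← hU.2, eLpNorm_map_measure _ hU.1.aemeasurable]
  · rfl
  · rw [hU.2]
    exact ((hqp (v n)).sub (hqp v₀)).aestronglyMeasurable

end CondRisk

/-! ### Continuity of minimizers -/

section ArgMin

variable {𝒳 E : Type*} [TopologicalSpace 𝒳] [NormedAddCommGroup E] [NormedSpace ℝ E]
  [ProperSpace E] {Z : Set E} {R : 𝒳 → Z → ℝ}

/-- The decision set `Z` is closed and convex, and `R x` is convex on `Z` for every `x`. For the
conditional risk this is `IsConvexProblem`. -/
def ConvexInDecision {𝒳 E : Type*} [NormedAddCommGroup E] [NormedSpace ℝ E] {Z : Set E}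
    (R : 𝒳 → Z → ℝ) : Prop :=
  IsClosed Z ∧ Convex ℝ Z ∧
    ∀ (x : 𝒳) (z₁ z₂ z : Z) (t : ℝ), 0 ≤ t → t ≤ 1 →
      (z : E) = t • (z₁ : E) + (1 - t) • (z₂ : E) →
      R x z ≤ t * R x z₁ + (1 - t) * R x z₂

/-- If `z₀` is the only minimizer of `R x₀`, the minimizers of `R x` for `x` near `x₀` are near `z₀`.
On a compact set `K` of decisions away from `z₀` one has `R x z₀ < R x z`, uniformly for `x` near
`x₀`. If `Z` is compact, `K` is the complement of a ball around `z₀`; in the convex case `K` is a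
sphere around `z₀`, which the segment from `z₀` to any far minimizer has to cross. -/
theorem eventually_dist_minimizer_lt (hR : Continuous (Function.uncurry R))
    (hreg : ConvexInDecision R ∨ IsCompact Z) {x₀ : 𝒳} {z₀ : Z}
    (hz₀ : ∀ z, R x₀ z₀ ≤ R x₀ z) (huniq : ∀ z, (∀ z', R x₀ z ≤ R x₀ z') → z = z₀)
    {ε : ℝ} (hε : 0 < ε) :
    ∀ᶠ x in 𝓝 x₀, ∀ z, (∀ z', R x z ≤ R x z') → dist z z₀ < ε := by
  have hsep : ∀ K : Set Z, IsCompact K → z₀ ∉ K → ∀ᶠ x in 𝓝 x₀, ∀ z ∈ K, R x z₀ < R x z := by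
    intro K hK hzK
    refine hK.eventually_forall_of_forall_eventually fun z hz => ?_
    have hlt : R x₀ z₀ < R x₀ z := by
      by_contra! hle
      exact hzK (huniq z (fun z' => hle.trans (hz₀ z')) ▸ hz)
    have h1 : Continuous fun v : 𝒳 × Z => R v.1 z₀ :=
      hR.comp (continuous_fst.prodMk continuous_const)
    exact (h1.tendsto (x₀, z)).eventually_lt (hR.tendsto (x₀, z)) hlt
  rcases hreg with ⟨hcl, hconv, hRc⟩ | hcomp
  · have hK : IsCompact (Metric.sphere z₀ ε) := by
      have := hcl.isClosedEmbedding_subtypeVal.isCompact_preimage (isCompact_sphere (z₀ : E) ε)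
      exact this
    filter_upwards [hsep _ hK (by simp [hε.ne])] with x hx z hz
    by_contra! hle
    -- the point of the segment from `z₀` to `z` that lies on the sphere
    set t : ℝ := ε / dist z z₀ with ht
    have hd : 0 < dist z z₀ := hε.trans_le hle
    have ht0 : 0 ≤ t := by positivity
    have ht1 : t ≤ 1 := (div_le_one hd).mpr hle
    have hmem : t • (z : E) + (1 - t) • (z₀ : E) ∈ Z :=
      hconv z.2 z₀.2 ht0 (by linarith) (by ring)
    have hsph : (⟨_, hmem⟩ : Z) ∈ Metric.sphere z₀ ε := by
      rw [Metric.mem_sphere, Subtype.dist_eq, dist_eq_norm]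
      have h2 : t • (z : E) + (1 - t) • (z₀ : E) - z₀ = t • ((z : E) - z₀) := by module
      rw [h2, norm_smul, Real.norm_of_nonneg ht0, ← dist_eq_norm, ← Subtype.dist_eq, ht]
      exact div_mul_cancel₀ _ hd.ne'
    have h3 := hRc x z z₀ ⟨_, hmem⟩ t ht0 ht1 rfl
    have h4 := hx _ hsph
    nlinarith [hz z₀]
  · have : CompactSpace Z := isCompact_iff_compactSpace.mp hcomp
    have hK : IsCompact {z : Z | ε ≤ dist z z₀} :=
      (isClosed_le continuous_const (continuous_id.dist continuous_const)).isCompact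
    filter_upwards [hsep _ hK (by simp [hε])] with x hx z hz
    by_contra! hle
    exact absurd (hz z₀) (not_le.mpr (hx z hle))

theorem continuousOn_minimizer (hR : Continuous (Function.uncurry R))
    (hreg : ConvexInDecision R ∨ IsCompact Z) {zstar : 𝒳 → Z}
    (hz : ∀ x, (∃! z, ∀ z', R x z ≤ R x z') → ∀ z', R x (zstar x) ≤ R x z') :
    ContinuousOn zstar {x | ∃! z, ∀ z', R x z ≤ R x z'} := by
  intro x₀ hx₀
  refine Metric.tendsto_nhds.mpr fun ε hε => ?_
  have h := eventually_dist_minimizer_lt hR hreg (hz x₀ hx₀)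
    (fun z hmin => hx₀.unique hmin (hz x₀ hx₀)) hε
  filter_upwards [nhdsWithin_le_nhds h, self_mem_nhdsWithin] with x hx hxu
  exact hx _ (hz x hxu)

end ArgMin

/-! ### Improving a suboptimal policy -/

section Improvement

variable {𝒳 E : Type*} [PseudoMetricSpace 𝒳] [SecondCountableTopology 𝒳] [MeasurableSpace 𝒳]
  [OpensMeasurableSpace 𝒳]
  [NormedAddCommGroup E] [NormedSpace ℝ E] {Z : Set E} {R b : 𝒳 → Z → ℝ}

/-- In the convex case a policy `g` that is suboptimal with positive probability is improved by moving
it, on a small ball around a suitable context `x₀`, part of the way towards a decision `z₀` that is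
better than `g x₀` at `x₀`. Convexity keeps the risk below that of `g`. The function `b` stands for the
`p`-th moment controlling admissibility, which is bounded along the moved part. -/
theorem exists_improving_policy_of_convex {μ : Measure 𝒳} [IsFiniteMeasure μ]
    (hR : Continuous (Function.uncurry R)) (hconv : ConvexInDecision R)
    (hb : Continuous (Function.uncurry b)) (hb0 : ∀ x z, 0 ≤ b x z)
    {g : 𝒳 → Z} (hg : Continuous g) (hgb : Integrable (fun x => b x (g x)) μ)
    (hopt : ¬ ∀ᵐ x ∂μ, ∀ z, R x (g x) ≤ R x z) :
    ∃ g' : 𝒳 → Z, Continuous g' ∧ Integrable (fun x => b x (g' x)) μ ∧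
      (∀ x, R x (g' x) ≤ R x (g x)) ∧ 0 < μ {x | R x (g' x) < R x (g x)} := by
  obtain ⟨-, hZ, hRc⟩ := hconv
  -- a context all of whose neighbourhoods contain suboptimal contexts with positive probability
  obtain ⟨x₀, hx₀, hpos⟩ := exists_mem_forall_mem_nhdsWithin_pos_measure (μ := μ)
    (s := {x | ¬ ∀ z, R x (g x) ≤ R x z}) hopt
  obtain ⟨z₀, hz₀⟩ : ∃ z₀, R x₀ z₀ < R x₀ (g x₀) := by simpa using hx₀
  have hmem : ∀ (x : 𝒳) (t : unitInterval),
      (t : ℝ) • (z₀ : E) + (1 - (t : ℝ)) • (g x : E) ∈ Z := fun x t =>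
    hZ z₀.2 (g x).2 t.2.1 (by linarith [t.2.2]) (by ring)
  -- The segment from `g x` to `z₀`. Bounding `b` on all of it is needed since the point of it that
  -- is chosen depends on the ball, and the ball on the bound.
  let G : 𝒳 → unitInterval → Z := fun x t => ⟨_, hmem x t⟩
  have hG : Continuous (Function.uncurry G) := by
    refine Continuous.subtype_mk ?_ _
    have h1 : Continuous fun v : 𝒳 × unitInterval => (v.2 : ℝ) :=
      continuous_subtype_val.comp continuous_snd
    have h2 : Continuous fun v : 𝒳 × unitInterval => (g v.1 : E) :=
      continuous_subtype_val.comp (hg.comp continuous_fst)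
    exact (h1.smul continuous_const).add ((continuous_const.sub h1).smul h2)
  have hbG : Continuous fun v : 𝒳 × unitInterval => b v.1 (G v.1 v.2) :=
    hb.comp (continuous_fst.prodMk hG)
  obtain ⟨M, hM⟩ : ∃ M, ∀ t, b x₀ (G x₀ t) < M := by
    obtain ⟨M, hM⟩ := (isCompact_range (hbG.comp (Continuous.prodMk_right x₀))).bddAbove
    exact ⟨M + 1, fun t => lt_of_le_of_lt (hM (mem_range_self t)) (lt_add_one M)⟩
  have hev1 : ∀ᶠ x in 𝓝 x₀, ∀ t ∈ (univ : Set unitInterval), b x (G x t) < M :=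
    isCompact_univ.eventually_forall_of_forall_eventually fun t _ =>
      (hbG.tendsto (x₀, t)).eventually (eventually_lt_nhds (hM t))
  have hev2 : ∀ᶠ x in 𝓝 x₀, R x z₀ < R x (g x) :=
    ((hR.comp (Continuous.prodMk_left z₀)).tendsto x₀).eventually_lt
      ((hR.comp (continuous_id.prodMk hg)).tendsto x₀) hz₀
  obtain ⟨ε, hε, hnear⟩ := Metric.eventually_nhds_iff.mp (hev1.and hev2)
  -- The weight of `z₀` in the new policy: positive inside the ball, zero outside.
  let lam : 𝒳 → unitInterval := fun x => projIcc 0 1 zero_le_one (1 - dist x x₀ / ε)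
  have hlam : Continuous lam :=
    continuous_projIcc.comp (continuous_const.sub
      ((continuous_id.dist continuous_const).div_const ε))
  have hlam0 : ∀ x, ε ≤ dist x x₀ → lam x = 0 := fun x hx =>
    projIcc_of_le_left _ (by linarith [(one_le_div hε).mpr hx])
  have hlam1 : ∀ x, dist x x₀ < ε → 0 < (lam x : ℝ) := fun x hx => by
    have h1 := (div_lt_one hε).mpr hx
    rw [show (lam x : ℝ) = max 0 (min 1 (1 - dist x x₀ / ε)) from coe_projIcc _ _ _ _]
    exact lt_max_of_lt_right (lt_min one_pos (by linarith))
  have hGc : ∀ x, R x (G x (lam x)) ≤ lam x * R x z₀ + (1 - lam x) * R x (g x) := fun x =>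
    hRc x z₀ (g x) _ (lam x) (lam x).2.1 (lam x).2.2 rfl
  have hG0 : ∀ x, ε ≤ dist x x₀ → G x (lam x) = g x := fun x hx => by
    apply Subtype.ext
    simp [G, hlam0 x hx]
  have hlt : ∀ x, dist x x₀ < ε → R x (G x (lam x)) < R x (g x) := fun x hx => by
    have h1 := mul_lt_mul_of_pos_left (hnear hx).2 (hlam1 x hx)
    linarith [hGc x]
  have hGcont : Continuous fun x => G x (lam x) := hG.comp (continuous_id.prodMk hlam)
  refine ⟨fun x => G x (lam x), hGcont, ?_, fun x => ?_, ?_⟩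
  · have hM0 : 0 ≤ M := (hb0 _ _).trans (hM 0).le
    refine (hgb.add (integrable_const M)).mono'
      (hb.comp (continuous_id.prodMk hGcont)).aestronglyMeasurable
      (Eventually.of_forall fun x => ?_)
    change ‖b x (G x (lam x))‖ ≤ b x (g x) + M
    rw [Real.norm_of_nonneg (hb0 _ _)]
    rcases lt_or_ge (dist x x₀) ε with hx | hx
    · linarith [(hnear hx).1 (lam x) (mem_univ _), hb0 x (g x)]
    · rw [hG0 x hx]; linarith
  · rcases lt_or_ge (dist x x₀) ε with hx | hx
    · exact (hlt x hx).le
    · exact (congrArg (R x) (hG0 x hx)).le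
  · exact (hpos _ (mem_nhdsWithin_of_mem_nhds (Metric.ball_mem_nhds x₀ hε))).trans_le
      (measure_mono fun x hx => hlt x hx)

/-- A policy `g` that is suboptimal with positive probability is improved by another admissible
continuous policy: by a local move in the convex case, and otherwise by the map of unique minimizers,
which is then continuous. -/
theorem exists_improving_policy [ProperSpace E] {μ : Measure 𝒳} [IsFiniteMeasure μ]
    (hR : Continuous (Function.uncurry R)) (hreg : ConvexInDecision R ∨ IsCompact Z)
    (hb : Continuous (Function.uncurry b)) (hb0 : ∀ x z, 0 ≤ b x z)
    (hcase : ConvexInDecision R ∨ ((∀ x, ∃! z, ∀ z', R x z ≤ R x z') ∧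
      ∀ g : 𝒳 → Z, Continuous g → Integrable (fun x => b x (g x)) μ))
    {g : 𝒳 → Z} (hg : Continuous g) (hgb : Integrable (fun x => b x (g x)) μ)
    (hopt : ¬ ∀ᵐ x ∂μ, ∀ z, R x (g x) ≤ R x z) :
    ∃ g' : 𝒳 → Z, Continuous g' ∧ Integrable (fun x => b x (g' x)) μ ∧
      (∀ x, R x (g' x) ≤ R x (g x)) ∧ 0 < μ {x | R x (g' x) < R x (g x)} := by
  rcases hcase with hconv | ⟨huniq, hadm⟩
  · exact exists_improving_policy_of_convex hR hconv hb hb0 hg hgb hopt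
  · choose zstar hmin heq using huniq
    have hcont : Continuous zstar := by
      rw [← continuousOn_univ]
      refine (continuousOn_minimizer hR hreg fun x _ => hmin x).mono fun x _ => ?_
      exact ⟨zstar x, hmin x, heq x⟩
    refine ⟨zstar, hcont, hadm _ hcont, fun x => hmin x _, pos_iff_ne_zero.mpr fun h0 => hopt ?_⟩
    refine measure_mono_null (fun x hx => ?_) h0
    obtain ⟨z, hz⟩ : ∃ z, R x z < R x (g x) := by simpa using hx
    exact (hmin x z).trans_lt hz

end Improvement

/-! ### Admissibility as integrability over contexts -/

theorem exAnteAdmissible_iff {𝒳 𝒴 𝒵 : Type*} [MeasurableSpace 𝒳] [MeasurableSpace 𝒴]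
    [TopologicalSpace 𝒳] [OpensMeasurableSpace 𝒳] [SecondCountableTopology 𝒳]
    [TopologicalSpace 𝒴] [OpensMeasurableSpace 𝒴] [SecondCountableTopology 𝒴]
    [TopologicalSpace 𝒵] {p : ℝ} (hp : 1 ≤ p)
    {μ : Measure 𝒳} [IsProbabilityMeasure μ] {κ : Kernel 𝒳 𝒴} [IsMarkovKernel κ]
    {c : 𝒵 → 𝒴 → ℝ} (hc : Continuous (Function.uncurry c))
    (hint : ∀ x z, Integrable (fun y => |c z y| ^ p) (κ x)) {g : 𝒳 → 𝒵} (hg : Continuous g) :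
    ExAnteAdmissible p (μ ⊗ₘ κ) c g ↔ Integrable (fun x => ∫ y, |c (g x) y| ^ p ∂(κ x)) μ := by
  have hp0 : 0 < p := by linarith
  have hl : Continuous (loss c g) :=
    hc.comp ((hg.comp continuous_fst).prodMk continuous_snd)
  have hpow : Continuous fun w => |loss c g w| ^ p := hl.abs.rpow_const fun _ => Or.inr hp0.le
  have h1 := integrable_norm_rpow_iff (μ := μ ⊗ₘ κ) (p := ENNReal.ofReal p)
    hl.aestronglyMeasurable (by simpa using hp0) (by simp)
  rw [ENNReal.toReal_ofReal hp0.le] at h1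
  rw [ExAnteAdmissible, ← h1]
  simp only [Real.norm_eq_abs]
  rw [Measure.integrable_compProd_iff hpow.aestronglyMeasurable]
  have h2 : ∀ x y, ‖|loss c g (x, y)| ^ p‖ = |c (g x) y| ^ p := fun x y =>
    Real.norm_of_nonneg (by positivity)
  simp_rw [h2]
  exact and_iff_right (Eventually.of_forall fun x => hint x (g x))

theorem exPostAdmissible_iff {Ω S 𝒳 𝒴 𝒵 : Type*} [MeasurableSpace Ω] [MeasurableSpace 𝒳]
    [MeasurableSpace 𝒴] [TopologicalSpace 𝒳] [OpensMeasurableSpace 𝒳] [TopologicalSpace 𝒵]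
    {p : ℝ} (hp : 1 ≤ p) {Pr : Measure Ω} {ρ : (S → ℝ) → ℝ} {U : S → ℝ}
    {κ : Kernel 𝒳 𝒴} {c : 𝒵 → 𝒴 → ℝ} (hR : Continuous (Function.uncurry (condRisk ρ U κ c)))
    {X : Ω → 𝒳} (hX : Measurable X) {g : 𝒳 → 𝒵} (hg : Continuous g) :
    ExPostAdmissible p Pr ρ U κ c X g ↔
      Integrable (fun x => |condRisk ρ U κ c x (g x)| ^ p) (Pr.map X) := by
  have hp0 : 0 < p := by linarith
  have hRg : Continuous fun x => condRisk ρ U κ c x (g x) := hR.comp (continuous_id.prodMk hg)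
  have hpow : Continuous fun x => |condRisk ρ U κ c x (g x)| ^ p :=
    hRg.abs.rpow_const fun _ => Or.inr hp0.le
  have h1 := integrable_norm_rpow_iff (μ := Pr) (p := ENNReal.ofReal p)
    (f := condRiskVar ρ U κ c X g) (hRg.measurable.comp hX).aestronglyMeasurable
    (by simpa using hp0) (by simp)
  rw [ENNReal.toReal_ofReal hp0.le] at h1
  rw [ExPostAdmissible, ← h1,
    integrable_map_measure hpow.aestronglyMeasurable hX.aemeasurable]
  rfl

end ContextualRisk

theorem mainTheorem1 {dx dy dz : ℕ}
    -- the sets of contexts, of problem data and of decisions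
    (𝒳 : Set (EuclideanSpace ℝ (Fin dx))) (𝒴 : Set (EuclideanSpace ℝ (Fin dy)))
    (𝒵 : Set (EuclideanSpace ℝ (Fin dz))) (p ι : ℝ) (hp : 1 ≤ p) (hι : 0 ≤ ι)
    -- the random vectors and the conditional distribution of the second given the first
    {Ω : Type*} [MeasurableSpace Ω] (Pr : Measure Ω) [IsProbabilityMeasure Pr]
    (X : Ω → 𝒳) (Y : Ω → 𝒴) (hX : Measurable X) (hY : Measurable Y)
    (κ : Kernel 𝒳 𝒴) [IsMarkovKernel κ]
    (hκ : Pr.map (fun ω => (X ω, Y ω)) = (Pr.map X) ⊗ₘ κ)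
    -- the inner risk measure, on an atomless probability space
    {S : Type*} [MeasurableSpace S] (PrS : Measure S) [IsProbabilityMeasure PrS]
    (U : S → ℝ) (hU : IsUniform PrS U) (ρ₂ : (S → ℝ) → ℝ)
    (hρ₂ : IsConvexRiskMeasure PrS p ρ₂) (hρ₂law : IsLawInvariant PrS p ρ₂)
    -- the cost
    (c : 𝒵 → 𝒴 → ℝ) (hc : Continuous (Function.uncurry c))
    (hgrowth : HasGrowth (fun y : 𝒴 => ‖(y : EuclideanSpace ℝ (Fin dy))‖) ι c)
    (hweak : IsWeaklyContinuous (fun y : 𝒴 => ‖(y : EuclideanSpace ℝ (Fin dy))‖) (ι * p) κ)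
    -- finite minimum and unique minimizer in almost every context
    (huniq : ∀ᵐ x ∂(Pr.map X), HasUniqueCondOptimal ρ₂ U κ c x)
    (hreg : IsConvexProblem 𝒵 ρ₂ U κ c ∨ IsCompact 𝒵) :
    -- (i)
    (∀ zstar : 𝒳 → 𝒵,
      (∀ x, HasUniqueCondOptimal ρ₂ U κ c x → IsCondOptimal ρ₂ U κ c x (zstar x)) →
        ContinuousOn zstar {x | HasUniqueCondOptimal ρ₂ U κ c x}) ∧
    -- (ii)
    (∀ ρEA : Measure (𝒳 × 𝒴) → (𝒳 × 𝒴 → ℝ) → ℝ,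
      IsStrictlyContextuallyConsistent 𝒵 p ρ₂ U ρEA →
      (IsConvexProblem 𝒵 ρ₂ U κ c ∨
        ((∀ x, HasUniqueCondOptimal ρ₂ U κ c x) ∧ ∀ g : 𝒳 → 𝒵, Continuous g →
          ExAnteAdmissible p (Pr.map (fun ω => (X ω, Y ω))) c g)) →
      ∀ gstar : 𝒳 → 𝒵,
        IsOptimalPolicy (ExAnteAdmissible p (Pr.map (fun ω => (X ω, Y ω))) c)
          (fun g => ρEA (Pr.map (fun ω => (X ω, Y ω))) (loss c g)) gstar →
        ∀ᵐ x ∂(Pr.map X), IsCondOptimal ρ₂ U κ c x (gstar x)) ∧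
    -- (iii)
    (∀ ρ₁ : (Ω → ℝ) → ℝ, IsStrictlyMonotone Pr p ρ₁ →
      (IsConvexProblem 𝒵 ρ₂ U κ c ∨
        ((∀ x, HasUniqueCondOptimal ρ₂ U κ c x) ∧ ∀ g : 𝒳 → 𝒵, Continuous g →
          ExPostAdmissible p Pr ρ₂ U κ c X g)) →
      ∀ gstar : 𝒳 → 𝒵,
        IsOptimalPolicy (ExPostAdmissible p Pr ρ₂ U κ c X)
          (fun g => ρ₁ (condRiskVar ρ₂ U κ c X g)) gstar →
        ∀ᵐ x ∂(Pr.map X), IsCondOptimal ρ₂ U κ c x (gstar x)) := by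
  have hnrm : Continuous fun y : 𝒴 => ‖(y : EuclideanSpace ℝ (Fin dy))‖ :=
    continuous_subtype_val.norm
  have hnrm0 : ∀ y : 𝒴, 0 ≤ ‖(y : EuclideanSpace ℝ (Fin dy))‖ := fun y => norm_nonneg _
  have hR : Continuous (Function.uncurry (condRisk ρ₂ U κ c)) :=
    continuous_condRisk hU hρ₂ hweak hnrm hnrm0 hp hι hc hgrowth
  have hp0 : 0 ≤ p := by linarith
  have hμ : IsProbabilityMeasure (Pr.map X) := Measure.isProbabilityMeasure_map hX.aemeasurable
  refine ⟨fun zstar hz => continuousOn_minimizer hR hreg hz, ?_, ?_⟩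
  · intro ρEA hcons hcase gstar ⟨hgc, hga, hmin⟩
    by_contra hopt
    rw [hκ] at hcase hga hmin
    have hadm : ∀ {g : 𝒳 → 𝒵}, Continuous g → (ExAnteAdmissible p (Pr.map X ⊗ₘ κ) c g ↔ _) :=
      fun {g} hg => exAnteAdmissible_iff hp hc
        (integrable_abs_rpow hweak hnrm0 hp hc hgrowth) hg
    obtain ⟨g, hg, hgi, hle, hlt⟩ := exists_improving_policy (μ := Pr.map X)
      (b := fun x z => ∫ y, |c z y| ^ p ∂(κ x)) hR hreg
      (continuous_integral_abs_rpow hweak hnrm hnrm0 hp hι hc hgrowth)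
      (fun x z => integral_nonneg fun y => by positivity)
      (hcase.imp_right fun h => ⟨h.1, fun g hg => (hadm hg).mp (h.2 g hg)⟩)
      hgc ((hadm hgc).mp hga) hopt
    have hfst : (Pr.map X ⊗ₘ κ).fst = Pr.map X := Measure.fst_compProd _ _
    refine absurd (hmin g hg ((hadm hg).mpr hgi)) (not_le.mpr ?_)
    refine hcons (Pr.map X ⊗ₘ κ) κ inferInstance inferInstance (by rw [hfst]) c g gstar hc hg hgc
      ((hadm hg).mpr hgi) hga (by rw [hfst]; exact Eventually.of_forall hle) (by rwa [hfst])
  · intro ρ₁ hmono hcase gstar ⟨hgc, hga, hmin⟩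
    by_contra hopt
    have hadm : ∀ {g : 𝒳 → 𝒵}, Continuous g → (ExPostAdmissible p Pr ρ₂ U κ c X g ↔ _) :=
      fun {g} hg => exPostAdmissible_iff hp hR hX hg
    obtain ⟨g, hg, hgi, hle, hlt⟩ := exists_improving_policy (μ := Pr.map X)
      (b := fun x z => |condRisk ρ₂ U κ c x z| ^ p) hR hreg
      (hR.abs.rpow_const fun _ => Or.inr hp0) (fun x z => by positivity)
      (hcase.imp_right fun h => ⟨h.1, fun g hg => (hadm hg).mp (h.2 g hg)⟩)
      hgc ((hadm hgc).mp hga) hopt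
    have hopen : IsOpen {x | condRisk ρ₂ U κ c x (g x) < condRisk ρ₂ U κ c x (gstar x)} :=
      isOpen_lt (hR.comp (continuous_id.prodMk hg)) (hR.comp (continuous_id.prodMk hgc))
    rw [Measure.map_apply hX hopen.measurableSet] at hlt
    exact absurd (hmin g hg ((hadm hg).mpr hgi)) (not_le.mpr
      (hmono _ _ hga ((hadm hg).mpr hgi) (Eventually.of_forall fun ω => hle (X ω)) hlt))
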